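/- For a matrix $A\in\mathbb{C}^{n\times n}$ none of whose eigenvalues is a non-positive integer, let $\Gamma(A)$ be the primary matrix function of the gamma function at $A$, i.e. $\Gamma(A)=q(A)$ for any polynomial $q$ with $q^{(k)}(\mu)=\Gamma^{(k)}(\mu)$ for every eigenvalue $\mu$ of $A$ and every $k$ smaller than the multiplicity of $\mu$ as a root of the minimal polynomial of $A$. Let $\|\cdot\|_p$ be the matrix norm induced by the $\ell^p$ vector norm, and for $\alpha>0$ put $$\omega(\alpha)=\frac{2\alpha+1}{\alpha^2(\alpha+1)^2}+\frac{\cosh(1)-1}{(\alpha+2)^2}.$$ Let $\widehat\lambda\in\mathbb{C}$, let $Q\in\mathbb{C}^{n\times n}$, and let $R\in\mathbb{R}^{n\times n}$ have non-negative entries with $|Q_{ij}|\le R_{ij}$ for all $i,j$. Suppose that $\mathrm{Re}(\widehat\lambda)-\|R\|_p>0$ for $p=1$ and for $p=\infty$, and define for these two $p$ $$\delta_p=\|R\|_p\Bigl(\Gamma'\bigl(\mathrm{Re}(\widehat\lambda)+\|R\|_p\bigr)+\omega\bigl(\mathrm{Re}(\widehat\lambda)+\|R\|_p\bigr)+\omega\bigl(\mathrm{Re}(\widehat\lambda)-\|R\|_p\bigr)\Bigr),$$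 and $\delta=\min(\delta_1,\delta_\infty)$. Then no eigenvalue of $\widehat\lambda I+Q$ is a non-positive integer, and $\Gamma(\widehat\lambda I+Q)$ lies in the complex interval matrix with midpoint $\Gamma(\widehat\lambda)I$ and radius $\delta$ times the all-ones matrix, i.e. $$\bigl|\bigl(\Gamma(\widehat\lambda I+Q)-\Gamma(\widehat\lambda)I\bigr)_{ij}\bigr|\le\delta\qquad\text{for all } i,j.$$ -/

import Mathlib

open scoped ENNReal

noncomputable section

/-- `p` takes at every eigenvalue `μ` of `A` the values `f μ, f' μ, …, f⁽ᵏ⁻¹⁾ μ`, where `k` is the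
multiplicity of `μ` in the minimal polynomial of `A` (the size of the largest Jordan block of `A`
at `μ`). Numbers that are not eigenvalues have multiplicity zero there and give no condition. -/
def InterpolatesOnSpectrum {n : ℕ} (f : ℂ → ℂ) (A : Matrix (Fin n) (Fin n) ℂ)
    (p : Polynomial ℂ) : Prop :=
  ∀ μ : ℂ, ∀ k : ℕ, k < (minpoly ℂ A).rootMultiplicity μ →
    (Polynomial.derivative^[k] p).eval μ = iteratedDeriv k f μ

/-- Any two such polynomials give the same matrix when evaluated at `A`. -/
theorem InterpolatesOnSpectrum.aeval_eq {n : ℕ} {f : ℂ → ℂ} {A : Matrix (Fin n) (Fin n) ℂ}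
    {p q : Polynomial ℂ} (hp : InterpolatesOnSpectrum f A p) (hq : InterpolatesOnSpectrum f A q) :
    Polynomial.aeval A p = Polynomial.aeval A q := by
  by_cases h0 : p - q = 0
  · rw [sub_eq_zero.mp h0]
  have hd : minpoly ℂ A ∣ p - q := by
    refine ((IsAlgClosed.splits (minpoly ℂ A)).dvd_iff_roots_le_roots
      (minpoly.ne_zero (Matrix.isIntegral A)) h0).mpr ?_
    rw [Multiset.le_iff_count]
    intro μ
    rw [Polynomial.count_roots, Polynomial.count_roots]
    rcases Nat.eq_zero_or_pos ((minpoly ℂ A).rootMultiplicity μ) with h | h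
    · omega
    have := Polynomial.lt_rootMultiplicity_of_isRoot_iterate_derivative
      (n := (minpoly ℂ A).rootMultiplicity μ - 1) (t := μ) h0 (fun m hm => by
        have h1 := hp μ m (by omega)
        have h2 := hq μ m (by omega)
        simp [Polynomial.IsRoot, h1, h2])
    omega
  rw [← sub_eq_zero, ← map_sub]
  exact (minpoly.dvd_iff).mp hd

open Classical in
/-- The primary matrix function `f(A)`, defined by Hermite interpolation: `f(A) = p(A)` for a
polynomial `p` that interpolates `f` on the spectrum of `A`. By the preceding lemma the value does
not depend on the choice of `p`. -/
def primaryMatrixFunction {n : ℕ} (f : ℂ → ℂ) (A : Matrix (Fin n) (Fin n) ℂ) :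
    Matrix (Fin n) (Fin n) ℂ :=
  if h : ∃ p : Polynomial ℂ, InterpolatesOnSpectrum f A p then Polynomial.aeval A h.choose else 0

/-- The matrix gamma function, meaningful when no eigenvalue of `A` is a non-positive integer. -/
def matrixGamma {n : ℕ} (A : Matrix (Fin n) (Fin n) ℂ) : Matrix (Fin n) (Fin n) ℂ :=
  primaryMatrixFunction Complex.Gamma A

/-- The matrix norm induced by the `ℓᵖ` vector norm, `1 ≤ p ≤ ∞`. -/
def matrixPNorm {𝕜 : Type*} [RCLike 𝕜] {n : ℕ} (p : ℝ≥0∞) [Fact (1 ≤ p)]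
    (A : Matrix (Fin n) (Fin n) 𝕜) : ℝ :=
  ‖LinearMap.toContinuousLinearMap (Matrix.toLpLin p p A)‖

/-- The complex interval matrix with midpoint `C` and radius `R`. -/
def intervalMatrix {m n : ℕ} (C : Matrix (Fin m) (Fin n) ℂ) (R : Matrix (Fin m) (Fin n) ℝ) :
    Set (Matrix (Fin m) (Fin n) ℂ) :=
  {M | ∀ i j, ‖M i j - C i j‖ ≤ R i j}

/-- `ω(α) = (2α + 1) / (α² (α + 1)²) + (cosh 1 - 1) / (α + 2)²`, used for `α > 0`. -/
def omegaBound (α : ℝ) : ℝ :=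
  (2 * α + 1) / (α ^ 2 * (α + 1) ^ 2) + (Real.cosh 1 - 1) / (α + 2) ^ 2

/-- `δ_p = ‖R‖_p (Γ'(Re lam + ‖R‖_p) + ω(Re lam + ‖R‖_p) + ω(Re lam - ‖R‖_p))`. -/
def deltaBound {n : ℕ} (p : ℝ≥0∞) [Fact (1 ≤ p)] (lam : ℂ) (R : Matrix (Fin n) (Fin n) ℝ) : ℝ :=
  matrixPNorm p R *
    (deriv Real.Gamma (lam.re + matrixPNorm p R) + omegaBound (lam.re + matrixPNorm p R)
      + omegaBound (lam.re - matrixPNorm p R))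

end

/-! Write A = λI + Q, a = Re λ and r = ‖R‖_p. A primary matrix function is linear in the jet of f on
the spectrum (`exists_linearMap_primaryMatrixFunction`). The spectrum lies in Re z > 0, where
Euler's integral may be differentiated under the integral sign, so the jet of Γ is the integral of
the jets of z ↦ t^(z-1) e^(-t). Hence Γ(A) - Γ(λ)I = ∫ t^(λ-1) e^(-t) (exp(log t · Q) - I) dt over
(0, ∞).

Entries of Q^m are at most r^m, so entries of the integrand are at most t^(a-1) e^(-t) (e^(r|log t|)
- 1) (`norm_apply_expJet_sub_le`). By e^x - 1 ≤ x e^x this is at most r |log t| t^(a±r-1) e^(-t),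
with + for t > 1 and - for t ≤ 1. Extending the tail integral to (0, ∞) gives Γ'(a+r); the
correction on (0, 1] is at most ω(a+r), and the part with a-r at most ω(a-r). -/

/-! ### Hermite interpolation and linearity in the jet -/

/-- The positions at which Hermite interpolation on the spectrum of `A` prescribes a value. -/
abbrev SpectralIndex {n : ℕ} (A : Matrix (Fin n) (Fin n) ℂ) : Type :=
  Σ μ : {μ // μ ∈ (minpoly ℂ A).roots.toFinset}, Fin ((minpoly ℂ A).rootMultiplicity (μ : ℂ))

/-- The values of a polynomial and its derivatives on the spectrum of `A`. -/
noncomputable def spectralJet {n : ℕ} (A : Matrix (Fin n) (Fin n) ℂ) :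
    Polynomial ℂ →ₗ[ℂ] (SpectralIndex A → ℂ) :=
  LinearMap.pi fun x => (Polynomial.leval (x.1 : ℂ)) ∘ₗ (Polynomial.derivative ^ (x.2 : ℕ))

theorem spectralJet_apply {n : ℕ} (A : Matrix (Fin n) (Fin n) ℂ) (p : Polynomial ℂ)
    (x : SpectralIndex A) :
    spectralJet A p x = (Polynomial.derivative^[(x.2 : ℕ)] p).eval (x.1 : ℂ) := by
  simp [spectralJet, Module.End.pow_apply, Polynomial.leval_apply]

theorem interpolatesOnSpectrum_iff {n : ℕ} (f : ℂ → ℂ) (A : Matrix (Fin n) (Fin n) ℂ)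
    (p : Polynomial ℂ) :
    InterpolatesOnSpectrum f A p ↔
      spectralJet A p = fun x => iteratedDeriv (x.2 : ℕ) f (x.1 : ℂ) := by
  constructor
  · intro h
    ext x
    rw [spectralJet_apply]
    exact h _ _ x.2.2
  · intro h μ k hk
    have hμ : μ ∈ (minpoly ℂ A).roots.toFinset := by
      rw [Multiset.mem_toFinset, ← Multiset.one_le_count_iff_mem, Polynomial.count_roots]
      omega
    have := congrFun h ⟨⟨μ, hμ⟩, ⟨k, hk⟩⟩
    rwa [spectralJet_apply] at this

theorem minpoly_dvd_of_spectralJet_eq_zero {n : ℕ} {A : Matrix (Fin n) (Fin n) ℂ}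
    {p : Polynomial ℂ} (hp : spectralJet A p = 0) : minpoly ℂ A ∣ p := by
  by_cases h0 : p = 0
  · simp [h0]
  refine ((IsAlgClosed.splits (minpoly ℂ A)).dvd_iff_roots_le_roots
    (minpoly.ne_zero (Matrix.isIntegral A)) h0).mpr ?_
  rw [Multiset.le_iff_count]
  intro μ
  rw [Polynomial.count_roots, Polynomial.count_roots]
  rcases Nat.eq_zero_or_pos ((minpoly ℂ A).rootMultiplicity μ) with h | h
  · omega
  have hμ : μ ∈ (minpoly ℂ A).roots.toFinset := by
    rw [Multiset.mem_toFinset, ← Multiset.one_le_count_iff_mem, Polynomial.count_roots]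
    omega
  have := Polynomial.lt_rootMultiplicity_of_isRoot_iterate_derivative
    (n := (minpoly ℂ A).rootMultiplicity μ - 1) (t := μ) h0 (fun m hm => by
      have h1 := congrFun hp ⟨⟨μ, hμ⟩, ⟨m, show m < (minpoly ℂ A).rootMultiplicity μ by omega⟩⟩
      rwa [spectralJet_apply] at h1)
  omega

theorem card_spectralIndex {n : ℕ} (A : Matrix (Fin n) (Fin n) ℂ) :
    Fintype.card (SpectralIndex A) = (minpoly ℂ A).natDegree := by
  rw [Fintype.card_sigma, (IsAlgClosed.splits (minpoly ℂ A)).natDegree_eq_card_roots,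
    ← Multiset.toFinset_sum_count_eq]
  simp only [Fintype.card_fin, Polynomial.count_roots]
  exact Finset.sum_coe_sort (minpoly ℂ A).roots.toFinset
    (fun μ => (minpoly ℂ A).rootMultiplicity μ)

/-- A jet vanishes only on multiples of the minimal polynomial, so the jet map is injective in
degrees below that of `minpoly`, and the dimensions agree. -/
theorem spectralJet_surjective {n : ℕ} (A : Matrix (Fin n) (Fin n) ℂ) :
    Function.Surjective (spectralJet A) := by
  set N := (minpoly ℂ A).natDegree with hN
  let J := (spectralJet A).comp (Polynomial.degreeLT ℂ N).subtype
  have hinj : Function.Injective J := by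
    rw [injective_iff_map_eq_zero]
    intro p hp
    have hd := minpoly_dvd_of_spectralJet_eq_zero (A := A) (p := p) hp
    have hlt := Polynomial.mem_degreeLT.mp p.2
    by_contra hne
    have hne' : (p : Polynomial ℂ) ≠ 0 := fun h => hne (Subtype.ext h)
    have := Polynomial.degree_le_of_dvd hd hne'
    rw [Polynomial.degree_eq_natDegree (minpoly.ne_zero (Matrix.isIntegral A))] at this
    exact absurd (this.trans_lt hlt) (lt_irrefl _)
  have hfin : FiniteDimensional ℂ (Polynomial.degreeLT ℂ N) :=
    (Polynomial.degreeLTEquiv ℂ N).symm.finiteDimensional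
  have hrank : Module.finrank ℂ (Polynomial.degreeLT ℂ N)
      = Module.finrank ℂ (SpectralIndex A → ℂ) := by
    rw [(Polynomial.degreeLTEquiv ℂ N).finrank_eq, Module.finrank_fintype_fun_eq_card,
      Module.finrank_fintype_fun_eq_card, card_spectralIndex, Fintype.card_fin]
  have hsurj := (LinearMap.injective_iff_surjective_of_finrank_eq_finrank hrank).mp hinj
  intro v
  obtain ⟨p, hp⟩ := hsurj v
  exact ⟨p, hp⟩

/-- A primary matrix function depends linearly on the values of the function and its derivatives
on the spectrum. -/
theorem exists_linearMap_primaryMatrixFunction {n : ℕ} (A : Matrix (Fin n) (Fin n) ℂ) :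
    ∃ L : (SpectralIndex A → ℂ) →ₗ[ℂ] Matrix (Fin n) (Fin n) ℂ,
      (∀ p : Polynomial ℂ, Polynomial.aeval A p = L (spectralJet A p)) ∧
      ∀ f : ℂ → ℂ, primaryMatrixFunction f A
        = L (fun x => iteratedDeriv (x.2 : ℕ) f (x.1 : ℂ)) := by
  -- `H` picks an interpolating polynomial linearly in the jet.
  obtain ⟨H, hH⟩ := (spectralJet A).exists_rightInverse_of_surjective
    (LinearMap.range_eq_top.mpr (spectralJet_surjective A))
  have key : ∀ p : Polynomial ℂ,
      Polynomial.aeval A p = Polynomial.aeval A (H (spectralJet A p)) := by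
    intro p
    rw [← sub_eq_zero, ← map_sub]
    refine (minpoly.dvd_iff).mp (minpoly_dvd_of_spectralJet_eq_zero ?_)
    rw [map_sub, sub_eq_zero]
    exact (LinearMap.congr_fun hH (spectralJet A p)).symm
  refine ⟨(Polynomial.aeval A).toLinearMap ∘ₗ H, key, fun f => ?_⟩
  have hex : ∃ p, InterpolatesOnSpectrum f A p := by
    obtain ⟨p, hp⟩ := spectralJet_surjective A fun x => iteratedDeriv (x.2 : ℕ) f (x.1 : ℂ)
    exact ⟨p, (interpolatesOnSpectrum_iff f A p).mpr hp⟩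
  rw [primaryMatrixFunction, dif_pos hex, key,
    (interpolatesOnSpectrum_iff f A _).mp hex.choose_spec]
  rfl

/-! ### Entrywise and spectral bounds from R -/

theorem matrixPNorm_nonneg {n : ℕ} (p : ℝ≥0∞) [Fact (1 ≤ p)] (R : Matrix (Fin n) (Fin n) ℝ) :
    0 ≤ matrixPNorm p R := norm_nonneg _

theorem norm_apply_le_matrixPNorm {n : ℕ} (p : ℝ≥0∞) [Fact (1 ≤ p)]
    (R : Matrix (Fin n) (Fin n) ℝ) (i j : Fin n) : ‖R i j‖ ≤ matrixPNorm p R := by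
  have h := (LinearMap.toContinuousLinearMap (Matrix.toLpLin p p R)).le_opNorm
    (PiLp.single p j (1 : ℝ))
  have h2 := PiLp.norm_apply_le (p := p)
    (LinearMap.toContinuousLinearMap (Matrix.toLpLin p p R) (PiLp.single p j (1 : ℝ))) i
  rw [PiLp.norm_single, norm_one, mul_one] at h
  refine le_trans (le_of_eq ?_) (h2.trans h)
  simp [Matrix.toLpLin_apply]

theorem matrixPNorm_pow_le {n : ℕ} (p : ℝ≥0∞) [Fact (1 ≤ p)]
    (R : Matrix (Fin n) (Fin n) ℝ) (k : ℕ) : matrixPNorm p (R ^ k) ≤ matrixPNorm p R ^ k := by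
  induction k with
  | zero =>
    simp only [pow_zero]
    -- Only an inequality: for n = 0 the identity has norm 0.
    refine ContinuousLinearMap.opNorm_le_bound _ zero_le_one fun x => ?_
    simp
  | succ k ih =>
    rw [pow_succ, pow_succ]
    refine le_trans ?_ (mul_le_mul_of_nonneg_right ih (matrixPNorm_nonneg p R))
    refine le_trans (le_of_eq ?_) (ContinuousLinearMap.opNorm_comp_le _ _)
    rw [matrixPNorm, Matrix.toLpLin_mul_same]
    rfl

theorem norm_pow_apply_le_of_norm_apply_le {n : ℕ} {Q : Matrix (Fin n) (Fin n) ℂ}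
    {R : Matrix (Fin n) (Fin n) ℝ} (hQ : ∀ i j, ‖Q i j‖ ≤ R i j) (k : ℕ) (i j : Fin n) :
    ‖(Q ^ k) i j‖ ≤ (R ^ k) i j := by
  induction k generalizing i j with
  | zero => by_cases h : i = j <;> simp [h]
  | succ k ih =>
    rw [pow_succ, pow_succ, Matrix.mul_apply, Matrix.mul_apply]
    refine (norm_sum_le _ _).trans (Finset.sum_le_sum fun l _ => ?_)
    rw [norm_mul]
    exact mul_le_mul (ih i l) (hQ l j) (norm_nonneg _) ((norm_nonneg _).trans (ih i l))

theorem norm_pow_apply_le_matrixPNorm_pow {n : ℕ} (p : ℝ≥0∞) [Fact (1 ≤ p)]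
    {Q : Matrix (Fin n) (Fin n) ℂ} {R : Matrix (Fin n) (Fin n) ℝ}
    (hQ : ∀ i j, ‖Q i j‖ ≤ R i j) (k : ℕ) (i j : Fin n) :
    ‖(Q ^ k) i j‖ ≤ matrixPNorm p R ^ k :=
  (norm_pow_apply_le_of_norm_apply_le hQ k i j).trans <|
    (Real.le_norm_self _).trans <|
      (norm_apply_le_matrixPNorm p (R ^ k) i j).trans (matrixPNorm_pow_le p R k)

/-- For an eigenvector v, |ν| |v| ≤ R |v| entrywise; sum over the entries, with |v| as a real test
vector for R. -/
theorem norm_le_matrixPNorm_one_of_mem_spectrum {n : ℕ}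
    {Q : Matrix (Fin n) (Fin n) ℂ} {R : Matrix (Fin n) (Fin n) ℝ}
    (hQ : ∀ i j, ‖Q i j‖ ≤ R i j) {ν : ℂ} (hν : ν ∈ spectrum ℂ Q) :
    ‖ν‖ ≤ matrixPNorm 1 R := by
  rw [← Matrix.spectrum_toLin', ← Module.End.hasEigenvalue_iff_mem_spectrum] at hν
  obtain ⟨v, hv⟩ := hν.exists_hasEigenvector
  have hmul : Q.mulVec v = ν • v := by simpa using hv.apply_eq_smul
  let w : PiLp 1 (fun _ : Fin n => ℝ) := WithLp.toLp 1 fun j => ‖v j‖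
  have hw : ‖w‖ = ∑ j, ‖v j‖ := by simp [PiLp.norm_eq_of_L1, w]
  have hpos : 0 < ∑ j, ‖v j‖ := by
    obtain ⟨j, hj⟩ := Function.ne_iff.mp hv.2
    exact Finset.sum_pos' (fun _ _ => norm_nonneg _) ⟨j, Finset.mem_univ _, norm_pos_iff.mpr hj⟩
  have h := (LinearMap.toContinuousLinearMap (Matrix.toLpLin 1 1 R)).le_opNorm w
  rw [hw, PiLp.norm_eq_of_L1] at h
  refine le_of_mul_le_mul_right (le_trans ?_ h) hpos
  rw [Finset.mul_sum]
  refine Finset.sum_le_sum fun i _ => ?_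
  have hi : ν * v i = ∑ j, Q i j * v j := by
    have := congrFun hmul i
    simpa [Matrix.mulVec, dotProduct] using this.symm
  rw [← norm_mul, hi]
  refine (norm_sum_le _ _).trans (le_trans ?_ (Real.le_norm_self _))
  have : (LinearMap.toContinuousLinearMap (Matrix.toLpLin 1 1 R) w) i = ∑ j, R i j * ‖v j‖ := by
    simp [Matrix.toLpLin_apply, Matrix.mulVec, dotProduct, w]
  rw [this]
  refine Finset.sum_le_sum fun j _ => ?_
  rw [norm_mul]
  exact mul_le_mul_of_nonneg_right (hQ i j) (norm_nonneg _)

theorem re_pos_of_mem_spectrum {n : ℕ} {lam : ℂ} {Q : Matrix (Fin n) (Fin n) ℂ}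
    {R : Matrix (Fin n) (Fin n) ℝ} (hQ : ∀ i j, ‖Q i j‖ ≤ R i j)
    (h : 0 < lam.re - matrixPNorm 1 R) {μ : ℂ}
    (hμ : μ ∈ spectrum ℂ (lam • (1 : Matrix (Fin n) (Fin n) ℂ) + Q)) : 0 < μ.re := by
  have h1 : μ - lam ∈ spectrum ℂ Q := by
    rw [← Algebra.algebraMap_eq_smul_one] at hμ
    rwa [← sub_add_cancel μ lam, spectrum.add_mem_add_iff] at hμ
  have h2 := norm_le_matrixPNorm_one_of_mem_spectrum hQ h1
  have h3 := (abs_le.mp (Complex.abs_re_le_norm (μ - lam))).1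
  rw [Complex.sub_re] at h3
  linarith

theorem SpectralIndex.mem_spectrum {n : ℕ} {A : Matrix (Fin n) (Fin n) ℂ} (x : SpectralIndex A) :
    (x.1 : ℂ) ∈ spectrum ℂ A := by
  have h := Multiset.mem_toFinset.mp x.1.2
  rw [Polynomial.mem_roots (minpoly.ne_zero (Matrix.isIntegral A))] at h
  rw [← Matrix.spectrum_toLin' (A := A), ← Module.End.hasEigenvalue_iff_mem_spectrum,
    Module.End.hasEigenvalue_iff_isRoot]
  rwa [Matrix.minpoly_toLin']

/-! ### Derivatives of Γ as Mellin integrals -/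

-- Each factor log t costs an arbitrarily small power of t at either end, so induction on k keeps
-- every exponent available.
open MeasureTheory Filter Topology Asymptotics Set in
theorem isBigO_log_pow_smul_exp_neg (k : ℕ) :
    LocallyIntegrableOn (fun t : ℝ => Real.log t ^ k • (Real.exp (-t) : ℂ)) (Ioi 0) ∧
    (∀ a : ℝ, (fun t : ℝ => Real.log t ^ k • (Real.exp (-t) : ℂ)) =O[atTop] (· ^ (-a))) ∧
    ∀ b : ℝ, 0 < b → (fun t : ℝ => Real.log t ^ k • (Real.exp (-t) : ℂ)) =O[𝓝[>] 0] (· ^ (-b)) := by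
  refine ⟨?_, ?_⟩
  · refine ContinuousOn.locallyIntegrableOn (fun t ht => ContinuousAt.continuousWithinAt ?_)
      measurableSet_Ioi
    have : t ≠ 0 := (Set.mem_Ioi.mp ht).ne'
    fun_prop (disch := assumption)
  · induction k with
    | zero =>
      refine ⟨fun a => ?_, fun b hb => ?_⟩
      · have := (isLittleO_exp_neg_mul_rpow_atTop one_pos (-a)).isBigO
        refine (IsBigO.of_bound 1 (Eventually.of_forall fun t => ?_)).trans this
        rw [pow_zero, one_smul, Complex.norm_real, neg_one_mul, one_mul]
      · have h1 : (fun t : ℝ => Real.log t ^ 0 • (Real.exp (-t) : ℂ)) =O[𝓝[>] 0]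
            (fun _ : ℝ => (1 : ℝ)) := by
          refine IsBigO.of_bound 1 ?_
          filter_upwards [self_mem_nhdsWithin] with t ht
          have : -t ≤ 0 := by linarith [Set.mem_Ioi.mp ht]
          rw [pow_zero, one_smul, Complex.norm_real]
          simpa using this
        refine h1.trans (IsBigO.of_bound 1 ?_)
        filter_upwards [Ioo_mem_nhdsGT one_pos] with t ht
        have := Real.one_le_rpow_of_pos_of_le_one_of_nonpos ht.1 ht.2.le (neg_nonpos.mpr hb.le)
        rw [norm_one, one_mul]
        exact this.trans (Real.le_norm_self _)
    | succ k ih =>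
      have e : (fun t : ℝ => Real.log t ^ (k + 1) • (Real.exp (-t) : ℂ))
          = fun t : ℝ => Real.log t • (Real.log t ^ k • (Real.exp (-t) : ℂ)) := by
        ext t; rw [smul_smul, pow_succ']
      rw [e]
      refine ⟨fun a => ?_, fun b hb => ?_⟩
      · exact isBigO_rpow_top_log_smul (lt_add_one a) (ih.1 (a + 1))
      · exact isBigO_rpow_zero_log_smul (half_lt_self hb) (ih.2 (b / 2) (half_pos hb))

theorem mellinConvergent_log_pow_smul_exp_neg (k : ℕ) {s : ℂ} (hs : 0 < s.re) :
    MellinConvergent (fun t : ℝ => Real.log t ^ k • (Real.exp (-t) : ℂ)) s := by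
  obtain ⟨h1, h2, h3⟩ := isBigO_log_pow_smul_exp_neg k
  exact mellinConvergent_of_isBigO_rpow h1 (h2 (s.re + 1)) (lt_add_one _) (h3 _ (half_pos hs))
    (half_lt_self hs)

theorem hasDerivAt_mellin_log_pow_smul_exp_neg (k : ℕ) {s : ℂ} (hs : 0 < s.re) :
    HasDerivAt (mellin fun t : ℝ => Real.log t ^ k • (Real.exp (-t) : ℂ))
      (mellin (fun t : ℝ => Real.log t ^ (k + 1) • (Real.exp (-t) : ℂ)) s) s := by
  obtain ⟨h1, h2, h3⟩ := isBigO_log_pow_smul_exp_neg k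
  have h := (mellin_hasDerivAt_of_isBigO_rpow h1 (h2 (s.re + 1)) (lt_add_one _)
    (h3 _ (half_pos hs)) (half_lt_self hs)).2
  have e : (fun t : ℝ => Real.log t ^ (k + 1) • (Real.exp (-t) : ℂ))
      = fun t : ℝ => Real.log t • (Real.log t ^ k • (Real.exp (-t) : ℂ)) := by
    ext t; rw [smul_smul, pow_succ']
  rwa [e]

open Filter Topology in
/-- On the right half plane, the `k`-th derivative of the gamma function is
`∫ t ^ (s - 1) * (log t) ^ k * exp (-t)`. -/
theorem iteratedDeriv_Gamma_eq_mellin (k : ℕ) {s : ℂ} (hs : 0 < s.re) :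
    iteratedDeriv k Complex.Gamma s
      = mellin (fun t : ℝ => Real.log t ^ k • (Real.exp (-t) : ℂ)) s := by
  induction k generalizing s with
  | zero =>
    rw [iteratedDeriv_zero, Complex.Gamma_eq_integral hs, Complex.GammaIntegral_eq_mellin]
    simp
  | succ k ih =>
    rw [iteratedDeriv_succ]
    have hev : iteratedDeriv k Complex.Gamma =ᶠ[𝓝 s]
        mellin fun t : ℝ => Real.log t ^ k • (Real.exp (-t) : ℂ) := by
      filter_upwards [(isOpen_lt continuous_const Complex.continuous_re).mem_nhds hs] with z hz
      exact ih hz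
    rw [hev.deriv_eq]
    exact (hasDerivAt_mellin_log_pow_smul_exp_neg k hs).deriv

/-! ### The scalar majorant and its integral -/

section

open MeasureTheory Set

theorem integrableOn_rpow_mul_log_mul_exp_neg {x : ℝ} (hx : 0 < x) :
    IntegrableOn (fun t : ℝ => t ^ (x - 1) * Real.log t * Real.exp (-t)) (Ioi 0) := by
  have h := (mellinConvergent_log_pow_smul_exp_neg 1 (s := x) (by simpa using hx)).re
  refine IntegrableOn.congr_fun h (fun t ht => ?_) measurableSet_Ioi
  have e : (t : ℂ) ^ ((x : ℂ) - 1) = ((t ^ (x - 1) : ℝ) : ℂ) := by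
    rw [Complex.ofReal_cpow (mem_Ioi.mp ht).le]; simp
  simp only [e, pow_one, Complex.real_smul, smul_eq_mul, ← Complex.ofReal_mul]
  rw [mul_assoc]
  rfl

theorem deriv_real_Gamma_eq_integral {x : ℝ} (hx : 0 < x) :
    deriv Real.Gamma x = ∫ t in Ioi (0 : ℝ), t ^ (x - 1) * Real.log t * Real.exp (-t) := by
  have hxc : 0 < (x : ℂ).re := by simpa using hx
  have hd : HasDerivAt Complex.Gamma (deriv Complex.Gamma x) (x : ℂ) := by
    refine (Complex.differentiableAt_Gamma _ fun m hm => ?_).hasDerivAt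
    have := congrArg Complex.re hm
    simp at this
    have : (0 : ℝ) ≤ m := m.cast_nonneg
    linarith
  have hr := hd.real_of_complex
  have e1 : (fun y : ℝ => (Complex.Gamma y).re) = Real.Gamma := by
    ext y; rw [Complex.Gamma_ofReal, Complex.ofReal_re]
  rw [e1] at hr
  have h1 := iteratedDeriv_Gamma_eq_mellin 1 hxc
  rw [iteratedDeriv_one] at h1
  rw [hr.deriv, h1, mellin]
  have e2 : ∫ t in Ioi (0 : ℝ), (t : ℂ) ^ ((x : ℂ) - 1) • (Real.log t ^ 1 • (Real.exp (-t) : ℂ))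
      = ∫ t in Ioi (0 : ℝ), ((t ^ (x - 1) * Real.log t * Real.exp (-t) : ℝ) : ℂ) := by
    refine setIntegral_congr_fun measurableSet_Ioi fun t ht => ?_
    have e : (t : ℂ) ^ ((x : ℂ) - 1) = ((t ^ (x - 1) : ℝ) : ℂ) := by
      rw [Complex.ofReal_cpow (mem_Ioi.mp ht).le]; simp
    simp only [e, pow_one, Complex.real_smul, smul_eq_mul, ← Complex.ofReal_mul]
    rw [mul_assoc]
  rw [e2, integral_complex_ofReal]
  exact Complex.ofReal_re _

/-- (1 + t + t²/2)(1 - t + t²/2) = 1 + t⁴/4 ≥ 1. -/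
theorem Real.exp_neg_le_quadratic {t : ℝ} (ht : 0 ≤ t) :
    Real.exp (-t) ≤ 1 - t + t ^ 2 / 2 := by
  have h1 := Real.quadratic_le_exp_of_nonneg ht
  have h2 : 0 < 1 - t + t ^ 2 / 2 := by nlinarith [sq_nonneg (t - 1)]
  rw [Real.exp_neg, inv_le_iff_one_le_mul₀ (Real.exp_pos t)]
  have h3 := mul_le_mul_of_nonneg_left h1 h2.le
  nlinarith [sq_nonneg (t ^ 2)]

theorem Real.exp_neg_le_one_sub_add_cosh {t : ℝ} (ht : 0 ≤ t) :
    Real.exp (-t) ≤ 1 - t + (Real.cosh 1 - 1) * t ^ 2 := by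
  have h1 := Real.exp_neg_le_quadratic ht
  have h2 : 1 / 2 ≤ Real.cosh 1 - 1 := by
    rw [Real.cosh_eq]
    linarith [Real.exp_one_gt_d9, Real.exp_neg_one_gt_d9]
  nlinarith [sq_nonneg t]

theorem Real.exp_sub_one_le_mul_exp (x : ℝ) : Real.exp x - 1 ≤ x * Real.exp x := by
  have h := mul_le_mul_of_nonneg_right (Real.one_sub_le_exp_neg x) (Real.exp_pos x).le
  rw [← Real.exp_add, neg_add_cancel, Real.exp_zero] at h
  linarith

theorem integral_rpow_mul_neg_log {b : ℝ} (hb : 0 < b) :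
    IntegrableOn (fun t : ℝ => t ^ (b - 1) * -Real.log t) (Ioc 0 1) ∧
      ∫ t in Ioc (0 : ℝ) 1, t ^ (b - 1) * -Real.log t = 1 / b ^ 2 := by
  -- An antiderivative, written with u log u at u = t^b so that continuity at 0 is immediate.
  let g : ℝ → ℝ := fun t => (t ^ b - t ^ b * Real.log (t ^ b)) / b ^ 2
  have hc : ContinuousOn g (Icc 0 1) := by
    have h1 : Continuous fun t : ℝ => t ^ b := Real.continuous_rpow_const hb.le
    exact ((h1.sub (Real.continuous_mul_log.comp h1)).div_const _).continuousOn
  have hd : ∀ t ∈ Ioo (0 : ℝ) 1, HasDerivAt g (t ^ (b - 1) * -Real.log t) t := by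
    intro t ht
    have h1 := Real.hasDerivAt_rpow_const (x := t) (p := b) (Or.inl ht.1.ne')
    have h2 := (Real.hasDerivAt_mul_log (Real.rpow_pos_of_pos ht.1 b).ne').comp t h1
    refine ((h1.sub h2).div_const (b ^ 2)).congr_deriv ?_
    rw [Real.log_rpow ht.1]
    field_simp
    ring
  have hi : IntegrableOn (fun t : ℝ => t ^ (b - 1) * -Real.log t) (Ioc 0 1) :=
    intervalIntegral.integrableOn_deriv_of_nonneg hc hd fun t ht =>
      mul_nonneg (Real.rpow_nonneg ht.1.le _) (neg_nonneg.mpr (Real.log_nonpos ht.1.le ht.2.le))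
  refine ⟨hi, ?_⟩
  rw [← intervalIntegral.integral_of_le zero_le_one,
    intervalIntegral.integral_eq_sub_of_hasDerivAt_of_le zero_le_one hc hd
      ((intervalIntegrable_iff_integrableOn_Ioc_of_le zero_le_one).mpr hi)]
  simp [g, Real.zero_rpow hb.ne']

/-- `ω(α)` is the integral over `(0, 1]` of a majorant of `t ^ (α - 1) * (-log t) * exp (-t)`. -/
theorem integral_eq_omegaBound {α : ℝ} (hα : 0 < α) :
    IntegrableOn (fun t : ℝ => t ^ (α - 1) * -Real.log t * (1 - t + (Real.cosh 1 - 1) * t ^ 2))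
        (Ioc 0 1) ∧
      ∫ t in Ioc (0 : ℝ) 1, t ^ (α - 1) * -Real.log t * (1 - t + (Real.cosh 1 - 1) * t ^ 2)
        = omegaBound α := by
  obtain ⟨i0, e0⟩ := integral_rpow_mul_neg_log hα
  obtain ⟨i1, e1⟩ := integral_rpow_mul_neg_log (b := α + 1) (by linarith)
  obtain ⟨i2, e2⟩ := integral_rpow_mul_neg_log (b := α + 2) (by linarith)
  have heq : EqOn (fun t : ℝ => t ^ (α - 1) * -Real.log t - t ^ (α + 1 - 1) * -Real.log t
      + (Real.cosh 1 - 1) * (t ^ (α + 2 - 1) * -Real.log t))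
      (fun t : ℝ => t ^ (α - 1) * -Real.log t * (1 - t + (Real.cosh 1 - 1) * t ^ 2))
      (Ioc 0 1) := by
    intro t ht
    have h1 : t ^ (α + 1 - 1) = t ^ (α - 1) * t := by
      rw [← Real.rpow_add_one ht.1.ne']; ring_nf
    have h2 : t ^ (α + 2 - 1) = t ^ (α - 1) * t ^ 2 := by
      rw [← Real.rpow_add_natCast ht.1.ne']; push_cast; ring_nf
    simp only [h1, h2]
    ring
  have i01 : IntegrableOn (fun t : ℝ => t ^ (α - 1) * -Real.log t
      - t ^ (α + 1 - 1) * -Real.log t) (Ioc 0 1) := i0.sub i1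
  refine ⟨(i01.add (i2.const_mul _)).congr_fun heq measurableSet_Ioc, ?_⟩
  -- The sum is 1/α² - 1/(α+1)² + (cosh 1 - 1)/(α+2)²; the first two terms combine into the first
  -- fraction of ω.
  rw [← setIntegral_congr_fun measurableSet_Ioc heq,
    integral_add i01 (i2.const_mul _), integral_sub i0 i1, integral_const_mul,
    e0, e1, e2, omegaBound]
  field_simp
  ring

/-- The majorant whose integral over `(0, ∞)` is `r * (Γ'(a + r) + ω(a + r) + ω(a - r))`. -/
noncomputable def gammaMajorant (a r t : ℝ) : ℝ :=
  r * (t ^ (a + r - 1) * Real.log t * Real.exp (-t) +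
    (Ioc (0 : ℝ) 1).indicator (fun t =>
      t ^ (a + r - 1) * -Real.log t * (1 - t + (Real.cosh 1 - 1) * t ^ 2) +
      t ^ (a - r - 1) * -Real.log t * (1 - t + (Real.cosh 1 - 1) * t ^ 2)) t)

theorem integral_gammaMajorant {a r : ℝ} (hr : 0 ≤ r) (har : 0 < a - r) :
    IntegrableOn (gammaMajorant a r) (Ioi 0) ∧
      ∫ t in Ioi (0 : ℝ), gammaMajorant a r t
        = r * (deriv Real.Gamma (a + r) + omegaBound (a + r) + omegaBound (a - r)) := by
  have har' : 0 < a + r := by linarith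
  obtain ⟨i1, e1⟩ := integral_eq_omegaBound har'
  obtain ⟨i2, e2⟩ := integral_eq_omegaBound har
  have i0 := integrableOn_rpow_mul_log_mul_exp_neg har'
  have i12 : IntegrableOn (fun t : ℝ =>
      t ^ (a + r - 1) * -Real.log t * (1 - t + (Real.cosh 1 - 1) * t ^ 2) +
      t ^ (a - r - 1) * -Real.log t * (1 - t + (Real.cosh 1 - 1) * t ^ 2)) (Ioc 0 1) :=
    i1.add i2
  have i3 := i12.integrable_indicator measurableSet_Ioc
  refine ⟨(i0.add i3.integrableOn).const_mul r, ?_⟩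
  unfold gammaMajorant
  rw [integral_const_mul, integral_add i0 i3.integrableOn,
    setIntegral_indicator measurableSet_Ioc,
    inter_eq_self_of_subset_right (Ioc_subset_Ioi_self), integral_add i1 i2, e1, e2,
    deriv_real_Gamma_eq_integral har']
  ring

/-- For t ≤ 1 the Γ' integrand is negative; the first indicator term compensates for it, leaving the
a - r term as the bound. For t > 1 the indicator vanishes and only e^x - 1 ≤ x e^x loses anything.
-/
theorem le_gammaMajorant {a r t : ℝ} (hr : 0 ≤ r) (ht : 0 < t) :
    t ^ (a - 1) * Real.exp (-t) * (Real.exp (|Real.log t| * r) - 1) ≤ gammaMajorant a r t := by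
  have hexp := Real.exp_sub_one_le_mul_exp (|Real.log t| * r)
  have hp : 0 ≤ t ^ (a - 1) * Real.exp (-t) := by positivity
  have h1 := mul_le_mul_of_nonneg_left hexp hp
  refine h1.trans ?_
  unfold gammaMajorant
  rcases le_or_gt t 1 with h | h
  · have hl : 0 ≤ -Real.log t := neg_nonneg.mpr (Real.log_nonpos ht.le h)
    rw [indicator_of_mem (show t ∈ Ioc (0 : ℝ) 1 from ⟨ht, h⟩), abs_of_nonpos (by linarith)]
    have e : t ^ (a - 1) * Real.exp (-Real.log t * r) = t ^ (a - r - 1) := by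
      rw [neg_mul, ← mul_neg, ← Real.rpow_def_of_pos ht, ← Real.rpow_add ht]; ring_nf
    have hE := Real.exp_neg_le_one_sub_add_cosh ht.le
    have k1 : 0 ≤ t ^ (a + r - 1) * -Real.log t := by positivity
    have k2 : 0 ≤ t ^ (a - r - 1) * -Real.log t := by positivity
    have m1 := mul_le_mul_of_nonneg_left hE k1
    have m2 := mul_le_mul_of_nonneg_left hE k2
    calc t ^ (a - 1) * Real.exp (-t) * (-Real.log t * r * Real.exp (-Real.log t * r))
        = r * (t ^ (a - r - 1) * -Real.log t * Real.exp (-t)) := by rw [← e]; ring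
      _ ≤ _ := mul_le_mul_of_nonneg_left (by linarith) hr
  · have hl : 0 ≤ Real.log t := Real.log_nonneg h.le
    rw [indicator_of_notMem (fun hm => absurd hm.2 (not_le.mpr h)), abs_of_nonneg hl]
    have e : t ^ (a - 1) * Real.exp (Real.log t * r) = t ^ (a + r - 1) := by
      rw [← Real.rpow_def_of_pos ht, ← Real.rpow_add ht]; ring_nf
    refine le_of_eq ?_
    rw [← e]; ring

/-! ### Matrix exponentials through jets, and the main estimate -/

-- The polynomials are Taylor sums of z ↦ exp(s(z - λ)) at λ, and the limit is the jet of that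
-- function.
open Filter Topology in
theorem tendsto_spectralJet_taylor_exp {n : ℕ} (A : Matrix (Fin n) (Fin n) ℂ) (lam s : ℂ) :
    Tendsto (fun N : ℕ => spectralJet A (∑ j ∈ Finset.range N,
        (s ^ j / (j.factorial : ℂ)) • (Polynomial.X - Polynomial.C lam) ^ j)) atTop
      (𝓝 fun x => s ^ (x.2 : ℕ) * Complex.exp (s * ((x.1 : ℂ) - lam))) := by
  rw [tendsto_pi_nhds]
  intro x
  have hterm : ∀ j : ℕ, spectralJet A
      ((s ^ j / (j.factorial : ℂ)) • (Polynomial.X - Polynomial.C lam) ^ j) x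
      = s ^ j / (j.factorial : ℂ) *
        ((j.descFactorial x.2 : ℂ) * ((x.1 : ℂ) - lam) ^ (j - (x.2 : ℕ))) := by
    intro j
    rw [map_smul, Pi.smul_apply, spectralJet_apply, Polynomial.iterate_derivative_X_sub_pow]
    simp
  simp only [map_sum, Finset.sum_apply, hterm]
  refine HasSum.tendsto_sum_nat ?_
  -- Terms below the derivative order vanish; the shifted series is s^k times an exponential series.
  rw [← hasSum_nat_add_iff' (x.2 : ℕ), Finset.sum_eq_zero, sub_zero]
  · have h := (NormedSpace.expSeries_div_hasSum_exp (s * ((x.1 : ℂ) - lam))).mul_left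
      (s ^ (x.2 : ℕ))
    rw [← Complex.exp_eq_exp_ℂ] at h
    refine h.congr_fun fun m => ?_
    have hf := Nat.factorial_mul_descFactorial (Nat.le_add_left (x.2 : ℕ) m)
    rw [Nat.add_sub_cancel] at hf ⊢
    have hm : (m.factorial : ℂ) ≠ 0 := Nat.cast_ne_zero.mpr m.factorial_ne_zero
    have hd : ((m + (x.2 : ℕ)).descFactorial x.2 : ℂ) ≠ 0 :=
      Nat.cast_ne_zero.mpr (Nat.descFactorial_pos.mpr (Nat.le_add_left _ _)).ne'
    rw [← hf, Nat.cast_mul, mul_pow, pow_add]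
    field_simp
  · intro j hj
    rw [Nat.descFactorial_of_lt (Finset.mem_range.mp hj)]
    simp

-- The image of this jet under `L` is exp(sQ). Its constant term cancels I, and the other terms are
-- dominated by the series of exp(‖s‖r) - 1.
open Filter Topology in
theorem norm_apply_expJet_sub_le {n : ℕ} (p : ℝ≥0∞) [Fact (1 ≤ p)] {lam : ℂ}
    {Q : Matrix (Fin n) (Fin n) ℂ} {R : Matrix (Fin n) (Fin n) ℝ}
    (hQ : ∀ i j, ‖Q i j‖ ≤ R i j)
    {A : Matrix (Fin n) (Fin n) ℂ} (hA : A = lam • (1 : Matrix (Fin n) (Fin n) ℂ) + Q)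
    {L : (SpectralIndex A → ℂ) →ₗ[ℂ] Matrix (Fin n) (Fin n) ℂ}
    (hL : ∀ q : Polynomial ℂ, Polynomial.aeval A q = L (spectralJet A q))
    (s : ℂ) (i j : Fin n) :
    ‖L (fun x => s ^ (x.2 : ℕ) * Complex.exp (s * ((x.1 : ℂ) - lam))) i j
      - (1 : Matrix (Fin n) (Fin n) ℂ) i j‖ ≤ Real.exp (‖s‖ * matrixPNorm p R) - 1 := by
  have hcont : Continuous fun v => L v i j :=
    (LinearMap.continuous_of_finiteDimensional (Matrix.entryLinearMap ℂ ℂ i j ∘ₗ L))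
  have ht := (hcont.tendsto _).comp (tendsto_spectralJet_taylor_exp A lam s)
  refine le_of_tendsto (ht.sub_const ((1 : Matrix (Fin n) (Fin n) ℂ) i j)).norm ?_
  -- N ≥ 1 ensures that the constant term is present.
  filter_upwards [eventually_ge_atTop 1] with N hN
  obtain ⟨N, rfl⟩ := Nat.exists_eq_add_of_le' hN
  have hsub : Polynomial.aeval A (Polynomial.X - Polynomial.C lam) = Q := by
    rw [map_sub, Polynomial.aeval_X, Polynomial.aeval_C, Algebra.algebraMap_eq_smul_one, hA]
    abel
  have hval : L (spectralJet A (∑ j ∈ Finset.range (N + 1),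
      (s ^ j / (j.factorial : ℂ)) • (Polynomial.X - Polynomial.C lam) ^ j)) i j
      - (1 : Matrix (Fin n) (Fin n) ℂ) i j
      = ∑ m ∈ Finset.range N, (s ^ (m + 1) / ((m + 1).factorial : ℂ)) * (Q ^ (m + 1)) i j := by
    rw [← hL, map_sum, Matrix.sum_apply, Finset.sum_range_succ']
    simp only [map_smul, map_pow, hsub, Matrix.smul_apply, smul_eq_mul]
    simp
  have hexp := Real.sum_le_exp_of_nonneg
    (mul_nonneg (norm_nonneg s) (matrixPNorm_nonneg p R)) (N + 1)
  rw [Finset.sum_range_succ'] at hexp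
  simp only [pow_zero, Nat.factorial_zero, Nat.cast_one, div_one] at hexp
  simp only [Function.comp_apply]
  rw [hval]
  refine le_trans (norm_sum_le _ _) (le_trans (Finset.sum_le_sum fun m _ => ?_)
    (le_sub_iff_add_le.mpr hexp))
  rw [norm_mul, norm_div, norm_pow, Complex.norm_natCast, mul_pow, mul_div_right_comm]
  exact mul_le_mul_of_nonneg_left (norm_pow_apply_le_matrixPNorm_pow p hQ _ i j) (by positivity)

/-- `hspec` is kept separate from `p`: the 1-norm bound on the spectrum supplies it for both norms.
-/
theorem norm_matrixGamma_sub_apply_le {n : ℕ} (p : ℝ≥0∞) [Fact (1 ≤ p)] {lam : ℂ}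
    {Q : Matrix (Fin n) (Fin n) ℂ} {R : Matrix (Fin n) (Fin n) ℝ}
    (hQ : ∀ i j, ‖Q i j‖ ≤ R i j) (h : 0 < lam.re - matrixPNorm p R)
    (hspec : ∀ μ ∈ spectrum ℂ (lam • (1 : Matrix (Fin n) (Fin n) ℂ) + Q), 0 < μ.re)
    (i j : Fin n) :
    ‖matrixGamma (lam • (1 : Matrix (Fin n) (Fin n) ℂ) + Q) i j
      - (Complex.Gamma lam • (1 : Matrix (Fin n) (Fin n) ℂ)) i j‖ ≤ deltaBound p lam R := by
  obtain ⟨A, hA⟩ : ∃ A, A = lam • (1 : Matrix (Fin n) (Fin n) ℂ) + Q := ⟨_, rfl⟩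
  rw [← hA] at hspec ⊢
  obtain ⟨L, hL, hΓ⟩ :=
    exists_linearMap_primaryMatrixFunction A
  have hr := matrixPNorm_nonneg p R
  have hlam : 0 < lam.re := by linarith
  let φ : (SpectralIndex A → ℂ) →L[ℂ] ℂ :=
    LinearMap.toContinuousLinearMap (Matrix.entryLinearMap ℂ ℂ i j ∘ₗ L)
  -- `F t` is the jet of z ↦ t^(z-1) e^(-t); `G` is its value at λ, with the power 0 kept to match
  -- the Mellin lemmas.
  let F : ℝ → SpectralIndex A → ℂ := fun t x =>
    (t : ℂ) ^ ((x.1 : ℂ) - 1) • (Real.log t ^ (x.2 : ℕ) • (Real.exp (-t) : ℂ))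
  let G : ℝ → ℂ := fun t => (t : ℂ) ^ (lam - 1) • (Real.log t ^ 0 • (Real.exp (-t) : ℂ))
  have hF' : ∀ x, IntegrableOn (fun t => F t x) (Ioi 0) := fun x =>
    mellinConvergent_log_pow_smul_exp_neg _ (hspec _ x.mem_spectrum)
  have hF : IntegrableOn F (Ioi 0) := Integrable.of_eval hF'
  have hG : IntegrableOn G (Ioi 0) := mellinConvergent_log_pow_smul_exp_neg 0 hlam
  have e1 : matrixGamma A i j = ∫ t in Ioi (0 : ℝ), φ (F t) := by
    rw [φ.integral_comp_comm hF, matrixGamma, hΓ]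
    have : (fun x : SpectralIndex A => iteratedDeriv (x.2 : ℕ) Complex.Gamma (x.1 : ℂ))
        = ∫ t in Ioi (0 : ℝ), F t := by
      ext x
      rw [eval_integral hF', iteratedDeriv_Gamma_eq_mellin _ (hspec _ x.mem_spectrum)]
      rfl
    rw [this]
    rfl
  have e2 : (Complex.Gamma lam • (1 : Matrix (Fin n) (Fin n) ℂ)) i j
      = ∫ t in Ioi (0 : ℝ), G t * (1 : Matrix (Fin n) (Fin n) ℂ) i j := by
    rw [integral_mul_const, Matrix.smul_apply, smul_eq_mul]
    congr 1
    have := iteratedDeriv_Gamma_eq_mellin 0 hlam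
    rwa [iteratedDeriv_zero] at this
  obtain ⟨hMi, hM⟩ := integral_gammaMajorant hr h
  rw [e1, e2, ← integral_sub (φ.integrable_comp hF) (hG.mul_const _), deltaBound, ← hM]
  refine norm_integral_le_of_norm_le hMi ?_
  filter_upwards [ae_restrict_mem measurableSet_Ioi] with t ht
  have ht0 : 0 < t := ht
  have htc : (t : ℂ) ≠ 0 := Complex.ofReal_ne_zero.mpr ht0.ne'
  refine le_trans (le_of_eq_of_le ?_ (mul_le_mul_of_nonneg_left
    (norm_apply_expJet_sub_le p hQ hA hL (Real.log t : ℂ) i j) (norm_nonneg (G t)))) ?_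
  -- t^(μ-1) = t^(λ-1) exp(log t · (μ-λ)), so `F t` is `G t` times the exponential jet with s = log
  -- t.
  · have hFt : F t = G t • fun x : SpectralIndex A =>
        (Real.log t : ℂ) ^ (x.2 : ℕ) * Complex.exp ((Real.log t : ℂ) * ((x.1 : ℂ) - lam)) := by
      ext x
      have : (t : ℂ) ^ ((x.1 : ℂ) - 1) = (t : ℂ) ^ (lam - 1) *
          Complex.exp ((Real.log t : ℂ) * ((x.1 : ℂ) - lam)) := by
        rw [Complex.ofReal_log ht0.le, ← Complex.cpow_def_of_ne_zero htc,
          ← Complex.cpow_add _ _ htc]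
        ring_nf
      simp only [F, G, Pi.smul_apply, this, smul_eq_mul, Complex.real_smul, pow_zero,
        Complex.ofReal_pow, Complex.ofReal_one]
      ring
    rw [hFt, map_smul, smul_eq_mul, ← mul_sub, norm_mul]
    rfl
  · have hGt : ‖G t‖ = t ^ (lam.re - 1) * Real.exp (-t) := by
      simp only [G, pow_zero, one_smul, norm_smul]
      rw [Complex.norm_cpow_eq_rpow_re_of_pos ht0, Complex.norm_real,
        Real.norm_of_nonneg (Real.exp_pos _).le]
      simp
    rw [hGt, Complex.norm_real, Real.norm_eq_abs]
    exact le_gammaMajorant hr ht0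

end

theorem corollary4p1 (n : ℕ) (lam : ℂ) (Q : Matrix (Fin n) (Fin n) ℂ)
    (R : Matrix (Fin n) (Fin n) ℝ)
    (hR : ∀ i j, 0 ≤ R i j)
    (hQ : ∀ i j, ‖Q i j‖ ≤ R i j)
    (h_one : 0 < lam.re - matrixPNorm 1 R)
    (h_top : 0 < lam.re - matrixPNorm ⊤ R) :
    (∀ μ ∈ spectrum ℂ (lam • (1 : Matrix (Fin n) (Fin n) ℂ) + Q), ∀ k : ℕ, μ ≠ -(k : ℂ)) ∧
    matrixGamma (lam • (1 : Matrix (Fin n) (Fin n) ℂ) + Q) ∈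
      intervalMatrix (Complex.Gamma lam • (1 : Matrix (Fin n) (Fin n) ℂ))
        (Matrix.of fun _ _ => min (deltaBound 1 lam R) (deltaBound ⊤ lam R)) := by
  have hspec : ∀ μ ∈ spectrum ℂ (lam • (1 : Matrix (Fin n) (Fin n) ℂ) + Q), 0 < μ.re :=
    fun μ hμ => re_pos_of_mem_spectrum hQ h_one hμ
  refine ⟨fun μ hμ k hk => ?_, fun i j => ?_⟩
  · have h1 := hspec μ hμ
    rw [hk, Complex.neg_re, Complex.natCast_re] at h1
    have h2 : (0 : ℝ) ≤ k := k.cast_nonneg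
    linarith
  · rw [Matrix.of_apply]
    exact le_min (norm_matrixGamma_sub_apply_le 1 hQ h_one hspec i j)
      (norm_matrixGamma_sub_apply_le ⊤ hQ h_top hspec i j)
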